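/- Let $R$ be a commutative noetherian ring. For an associative unital $R$-algebra $A$, call a left ideal $I \subseteq A$ cofinite if $A/I$ is a finitely generated $R$-module. Say that $A$ has property $\mathbf{P}_\ell$ if every cofinite left ideal $I$ of $A$ contains a left ideal $I_0 \subseteq I$ of $A$ such that $A/I_0$ is finitely generated and projective as an $R$-module. The finite dual of $A$ is $$A^\circ = \{ f \in \operatorname{Hom}_R(A,R) \mid Af \text{ is a finitely generated } R\text{-module}\}, \qquad (af)(b) = f(ba).$$ \textbf{Theorem.} Let $n \ge 0$. If an $R$-algebra $A$ has property $\mathbf{P}_\ell$, then the Laurent polynomial algebra $A[x_1, x_1^{-1}, \dots, x_n, x_n^{-1}]$ (in central commuting variables) has property $\mathbf{P}_\ell$ as an $R$-algebra. In particular, for $H = R[x_1, x_1^{-1}, \dots, x_n, x_n^{-1}]$, regarded as the group algebra $R[\mathbb{Z}^n]$ with its usual Hopf algebra structure ($\Delta(x_i) = x_i \otimes x_i$, $\varepsilon(x_i) = 1$, $S(x_i) = x_i^{-1}$), the finite dual $H^\circ$ is a Hopf algebra over $R$ with the structure dual to that of $H$: the product is the convolution $(f * g)(h) = \sum f(h_1)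 g(h_2)$, where $\Delta(h) = \sum h_1 \otimes h_2$; the unit is $\varepsilon$; the comultiplication satisfies $f(ab) = \sum f_1(a) f_2(b)$ for all $a, b \in H$, where $\sum f_1 \otimes f_2 \in H^\circ \otimes_R H^\circ$ is the comultiplication of $f$; the counit is $f \mapsto f(1)$; and the antipode is $f \mapsto f \circ S$. -/

import Mathlib

open scoped TensorProduct

universe u v

noncomputable section

/-- A left ideal `I` of the `R`-algebra `A` is cofinite if `A / I` is a finitely generated
`R`-module. (For a possibly noncommutative ring, `Ideal A` is the type of left ideals.) -/
def IsCofiniteLeftIdeal (R : Type*) {A : Type*} [CommRing R] [Ring A] [Algebra R A]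
    (I : Ideal A) : Prop :=
  Module.Finite R (A ⧸ I.restrictScalars R)

/-- Property `P_ℓ` of an `R`-algebra `A`: every cofinite left ideal `I` contains a left ideal `I₀`
such that `A / I₀` is finitely generated and projective as an `R`-module. -/
def HasPropertyPl (R A : Type*) [CommRing R] [Ring A] [Algebra R A] : Prop :=
  ∀ I : Ideal A, IsCofiniteLeftIdeal R I →
    ∃ I₀ : Ideal A, I₀ ≤ I ∧ Module.Finite R (A ⧸ I₀.restrictScalars R) ∧
      Module.Projective R (A ⧸ I₀.restrictScalars R)

/-- The algebra `A[x₁^{±1}, …, xₙ^{±1}]` of Laurent polynomials in `n` (central) variables, as the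
group algebra of `ℤⁿ` over `A`. For `A = R` it carries Mathlib's Hopf algebra structure of a group
algebra: the monomials are group-like and the antipode inverts them. -/
abbrev LaurentAlgebra (A : Type*) [Semiring A] (n : ℕ) : Type _ :=
  AddMonoidAlgebra A (Fin n → ℤ)

section FiniteDual

variable (R : Type*) [CommRing R]

/-- For `f` in the dual of `A`, the linear map `a ↦ a f`, where `(a f)(b) = f (b a)`.
Its range is the left `A`-submodule `A f` of the dual. -/
def dualOrbit {A : Type*} [Ring A] [Algebra R A] (f : Module.Dual R A) :
    A →ₗ[R] Module.Dual R A :=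
  (LinearMap.mul R A).flip.compr₂ f

theorem dualOrbit_apply {A : Type*} [Ring A] [Algebra R A] (f : Module.Dual R A) (a b : A) :
    dualOrbit R f a b = f (b * a) := rfl

variable [IsNoetherianRing R]

/-- The finite dual `A°` of an algebra `A` over a noetherian ring `R`: the functionals `f` on `A`
for which `A f` is a finitely generated `R`-module. -/
def finiteDual (A : Type*) [Ring A] [Algebra R A] : Submodule R (Module.Dual R A) where
  carrier := {f | (LinearMap.range (dualOrbit R f)).FG}
  zero_mem' := by
    have h : dualOrbit R (0 : Module.Dual R A) = 0 := by ext; rfl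
    simp only [Set.mem_ofPred_eq, h, LinearMap.range_zero]
    exact Submodule.fg_bot
  add_mem' := by
    intro f g hf hg
    refine Submodule.FG.of_le (Submodule.FG.sup hf hg) ?_
    rintro _ ⟨a, rfl⟩
    exact Submodule.add_mem_sup (LinearMap.mem_range_self (dualOrbit R f) a)
      (LinearMap.mem_range_self (dualOrbit R g) a)
  smul_mem' := by
    intro c f hf
    refine Submodule.FG.of_le hf ?_
    rintro _ ⟨a, rfl⟩
    exact ⟨c • a, by ext b; simp [dualOrbit_apply]⟩

variable (H : Type*) [Ring H] [Bialgebra R H]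

/-- The finite dual `H°` of a bialgebra `H`, as a subalgebra of the dual `H*` with the convolution
product `(f * g)(h) = ∑ f(h₁) g(h₂)` and with the counit of `H` as unit. -/
def finiteDualAlgebra : Subalgebra R (WithConv (H →ₗ[R] R)) where
  carrier := {f | f.ofConv ∈ finiteDual R H}
  add_mem' := fun hf hg => (finiteDual R H).add_mem hf hg
  mul_mem' := by
    intro f g hf hg
    let e : Module.Dual R H →ₗ[R] WithConv (H →ₗ[R] R) :=
      { toFun := WithConv.toConv, map_add' := fun _ _ => rfl, map_smul' := fun _ _ => rfl }
    let e' : WithConv (H →ₗ[R] R) →ₗ[R] Module.Dual R H :=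
      { toFun := WithConv.ofConv, map_add' := fun _ _ => rfl, map_smul' := fun _ _ => rfl }
    refine Submodule.FG.of_le (Submodule.FG.map e' (Submodule.FG.mul
      (Submodule.FG.map e hf) (Submodule.FG.map e hg))) ?_
    rintro _ ⟨a, rfl⟩
    let r := Coalgebra.Repr.arbitrary R a
    refine ⟨∑ i ∈ r.index, e (dualOrbit R f.ofConv (r.left i)) *
      e (dualOrbit R g.ofConv (r.right i)), ?_, ?_⟩
    · exact Submodule.sum_mem _ fun i _ => Submodule.mul_mem_mul
        ⟨_, ⟨_, rfl⟩, rfl⟩ ⟨_, ⟨_, rfl⟩, rfl⟩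
    · ext b
      let s := Coalgebra.Repr.arbitrary R b
      rw [map_sum, LinearMap.sum_apply, dualOrbit_apply]
      have key : Coalgebra.comul (R := R) (b * a) =
          ∑ i ∈ r.index, ∑ j ∈ s.index,
            (s.left j * r.left i) ⊗ₜ[R] (s.right j * r.right i) := by
        rw [Bialgebra.comul_mul, ← r.eq, ← s.eq, Finset.sum_mul_sum, Finset.sum_comm]
        simp
      have h2 : ∀ i, e' (e (dualOrbit R f.ofConv (r.left i)) *
          e (dualOrbit R g.ofConv (r.right i))) b =
          ∑ j ∈ s.index, f (s.left j * r.left i) * g (s.right j * r.right i) := by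
        intro i
        exact s.convMul_apply _ _
      have h3 : (f * g).ofConv (b * a) = ∑ i ∈ r.index, ∑ j ∈ s.index,
          f (s.left j * r.left i) * g (s.right j * r.right i) := by
        change LinearMap.mul' R R (TensorProduct.map f.ofConv g.ofConv
          (Coalgebra.comul (R := R) (b * a))) = _
        rw [key]
        simp
      rw [h3]
      exact Finset.sum_congr rfl fun i _ => h2 i
  algebraMap_mem' := by
    intro c
    refine Submodule.FG.of_le (Submodule.fg_span_singleton
      (Coalgebra.counit (R := R) (A := H) : Module.Dual R H)) ?_
    rintro _ ⟨a, rfl⟩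
    refine Submodule.mem_span_singleton.mpr ⟨c * Coalgebra.counit (R := R) a, ?_⟩
    ext b
    rw [dualOrbit_apply]
    simp
    ring

end FiniteDual

/-- For Hopf algebras `K` and `H` and a pairing `ev : K × H → R`: the comultiplication of `K` is
dual to the multiplication of `H`, i.e. `⟨k, a b⟩ = ∑ ⟨k₁, a⟩ ⟨k₂, b⟩` whenever `∑ k₁ ⊗ k₂`
represents the comultiplication of `k`, the counit of `K` is dual to the unit of `H`, i.e.
`ε(k) = ⟨k, 1⟩`, and the antipodes are dual to each other. -/
structure IsDualCoalgebraAntipode (R : Type*) {K H : Type*} [CommRing R] [Ring K] [HopfAlgebra R K]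
    [Ring H] [HopfAlgebra R H] (ev : K → H → R) : Prop where
  comul_eval : ∀ (k : K) (r : Coalgebra.Repr R k ℕ) (a b : H),
    ev k (a * b) = ∑ i ∈ r.index, ev (r.left i) a * ev (r.right i) b
  counit_eval : ∀ k : K, Coalgebra.counit (R := R) k = ev k 1
  antipode_eval : ∀ (k : K) (a : H),
    ev (HopfAlgebra.antipode R k) a = ev k (HopfAlgebra.antipode R a)

/-- `h` is the dual Hopf algebra structure on the finite dual `H°` of a Hopf algebra `H`: its
underlying algebra is the convolution algebra `H°` (so its multiplication is dual to the
comultiplication of `H` and its unit is the counit of `H`), and its comultiplication, counit and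
antipode are dual to the multiplication, unit and antipode of `H` under `⟨f, a⟩ = f(a)`. -/
structure IsDualHopfStructure (R H : Type*) [CommRing R] [IsNoetherianRing R] [Ring H]
    [HopfAlgebra R H] (h : HopfAlgebra R (finiteDualAlgebra R H)) : Prop where
  toAlgebra_eq : h.toAlgebra = (finiteDualAlgebra R H).algebra
  dual : @IsDualCoalgebraAntipode R (finiteDualAlgebra R H) H _ _ h _ _ (fun f a => f.1 a)

end

/-!
Let `I` be a cofinite left ideal of `A ⊗ B`. It contains `J ⊗ B + A ⊗ K`, where `J` and `K` are left
ideals inside `I ∩ A` and `I ∩ B` with finitely generated projective quotients; the quotient by this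
left ideal is `(A / J) ⊗ (B / K)`. So property `P_ℓ` passes to tensor products
(`HasPropertyPl.tensorProduct`). The algebra `R[T;T⁻¹]` has the property because modulo a cofinite
ideal both `T` and `T⁻¹` are integral over `R`, so the ideal contains a monic `q(T)` with constant
coefficient `1`, and `R[T;T⁻¹] / (q) = R[X] / (q)` is free of finite rank
(`hasPropertyPl_laurentPolynomial`). Since `A[ℤ] = A ⊗ R[T;T⁻¹]`, induction on `n` gives `P_ℓ` for
`A[ℤⁿ]` (`HasPropertyPl.laurentAlgebra`).

For any Hopf algebra `H` with property `P_ℓ`, the finite dual is a Hopf algebra. Given finitely many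
`f` in `H°`, some left ideal `I` on which they all vanish has `H / I` finitely generated projective,
and a dual basis of `H / I` yields `eᵢ` in `H` and `φᵢ` in `H°` such that
`f (a b) = ∑ f (a eᵢ) φᵢ(b)` for these `f` (`HasPropertyPl.exists_finiteDual_expansion`). This
formula exhibits the comultiplication `Δ f = ∑ (eᵢ f) ⊗ φᵢ` and shows that `f ∘ S` lies in `H°`. For
`a = 1` it shows that `H° ⊗ M → Hom(H, M)` is injective for every `M`
(`HasPropertyPl.finiteDual_rTensor_ext`), so tensors over `H°` are determined by their values and
each axiom of a Hopf algebra becomes the dual axiom of `H`.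
-/

/-! ### Cofinite left ideals and property `P_ℓ` -/

section PropertyPl

variable {R : Type*} [CommRing R]

section Noetherian

variable [IsNoetherianRing R] {A B : Type*} [Ring A] [Algebra R A] [Ring B] [Algebra R B]

theorem IsCofiniteLeftIdeal.comap {I : Ideal B} (hI : IsCofiniteLeftIdeal R I) (φ : A →ₐ[R] B) :
    IsCofiniteLeftIdeal R (I.comap φ) := by
  have : Module.Finite R (B ⧸ I.restrictScalars R) := hI
  let q : A →ₗ[R] B ⧸ I.restrictScalars R := (I.restrictScalars R).mkQ ∘ₗ φ.toLinearMap
  have hq : (I.comap φ).restrictScalars R = LinearMap.ker q := by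
    ext a
    simp [q]
  unfold IsCofiniteLeftIdeal
  rw [hq]
  exact Module.Finite.equiv q.quotKerEquivRange.symm

theorem IsCofiniteLeftIdeal.inf {I J : Ideal A} (hI : IsCofiniteLeftIdeal R I)
    (hJ : IsCofiniteLeftIdeal R J) : IsCofiniteLeftIdeal R (I ⊓ J) := by
  have : Module.Finite R (A ⧸ I.restrictScalars R) := hI
  have : Module.Finite R (A ⧸ J.restrictScalars R) := hJ
  let q : A →ₗ[R] (A ⧸ I.restrictScalars R) × (A ⧸ J.restrictScalars R) :=
    (I.restrictScalars R).mkQ.prod (J.restrictScalars R).mkQ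
  have hq : (I ⊓ J).restrictScalars R = LinearMap.ker q := by
    ext a
    simp [q]
  unfold IsCofiniteLeftIdeal
  rw [hq]
  exact Module.Finite.equiv q.quotKerEquivRange.symm

theorem HasPropertyPl.of_algEquiv (e : A ≃ₐ[R] B) (hA : HasPropertyPl R A) :
    HasPropertyPl R B := by
  intro I hI
  obtain ⟨J, hJI, hfin, hproj⟩ := hA _ (hI.comap e.toAlgHom)
  let q : B →ₗ[R] A ⧸ J.restrictScalars R := (J.restrictScalars R).mkQ ∘ₗ e.symm.toLinearMap
  have hq : (J.comap e.symm.toAlgHom).restrictScalars R = LinearMap.ker q := by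
    ext b
    simp [q]
  have hsurj : Function.Surjective q := (Submodule.mkQ_surjective _).comp e.symm.surjective
  refine ⟨J.comap e.symm.toAlgHom, fun b hb => ?_, ?_, ?_⟩
  · simpa using hJI hb
  · rw [hq]
    exact Module.Finite.equiv (q.quotKerEquivOfSurjective hsurj).symm
  · rw [hq]
    exact Module.Projective.of_equiv (q.quotKerEquivOfSurjective hsurj).symm

/-- If `J ⊆ A` and `K ⊆ B` are left ideals with finitely generated projective quotients, then
`J ⊗ B + A ⊗ K` is a left ideal of `A ⊗ B` with quotient `(A / J) ⊗ (B / K)`. -/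
theorem HasPropertyPl.tensorProduct (hA : HasPropertyPl R A) (hB : HasPropertyPl R B) :
    HasPropertyPl R (A ⊗[R] B) := by
  intro I hI
  obtain ⟨J, hJI, _, _⟩ := hA _ (hI.comap Algebra.TensorProduct.includeLeft)
  obtain ⟨K, hKI, _, _⟩ := hB _ (hI.comap Algebra.TensorProduct.includeRight)
  let q : A ⊗[R] B →ₗ[R] (A ⧸ J.restrictScalars R) ⊗[R] (B ⧸ K.restrictScalars R) :=
    TensorProduct.map (J.restrictScalars R).mkQ (K.restrictScalars R).mkQ
  have hsurj : Function.Surjective q :=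
    TensorProduct.map_surjective (Submodule.mkQ_surjective _) (Submodule.mkQ_surjective _)
  have hsub : ∀ (a : A) (b : B), a ∈ J ∨ b ∈ K → a ⊗ₜ[R] b ∈ I := by
    rintro a b (ha | hb)
    · simpa using I.mul_mem_left (1 ⊗ₜ b) (show a ⊗ₜ 1 ∈ I from hJI ha)
    · simpa using I.mul_mem_left (a ⊗ₜ 1) (show 1 ⊗ₜ b ∈ I from hKI hb)
  -- In this description the kernel is visibly stable under left multiplication by pure tensors.
  have hspan : LinearMap.ker q =
      Submodule.span R {t | ∃ a b, (a ∈ J ∨ b ∈ K) ∧ a ⊗ₜ[R] b = t} := by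
    refine le_antisymm ?_ (Submodule.span_le.mpr ?_)
    · rw [TensorProduct.map_ker (LinearMap.exact_subtype_mkQ (J.restrictScalars R))
        (Submodule.mkQ_surjective _) (LinearMap.exact_subtype_mkQ (K.restrictScalars R))
        (Submodule.mkQ_surjective _), sup_le_iff, LinearMap.range_le_iff_comap,
        LinearMap.range_le_iff_comap, Submodule.eq_top_iff', Submodule.eq_top_iff']
      constructor <;> intro t <;> rw [Submodule.mem_comap] <;> induction t with
      | zero => simp
      | add s t hs ht => rw [map_add]; exact add_mem hs ht
      | tmul a b => exact Submodule.subset_span ⟨_, _, by first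
          | exact .inl a.2
          | exact .inr b.2, rfl⟩
    · rintro _ ⟨a, b, hab | hab, rfl⟩
      · simp [q, (Submodule.Quotient.mk_eq_zero (J.restrictScalars R)).mpr hab]
      · simp [q, (Submodule.Quotient.mk_eq_zero (K.restrictScalars R)).mpr hab]
  let I₀ : Ideal (A ⊗[R] B) :=
    { (LinearMap.ker q).toAddSubmonoid with
      smul_mem' := by
        intro c t ht
        change t ∈ LinearMap.ker q at ht
        change c * t ∈ LinearMap.ker q
        rw [hspan] at ht ⊢
        induction c with
        | zero => simp
        | add x y hx hy => rw [add_mul]; exact add_mem hx hy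
        | tmul x y =>
          induction ht using Submodule.span_induction with
          | zero => simp
          | add s t _ _ hs ht => rw [mul_add]; exact add_mem hs ht
          | smul r t _ ht => rw [mul_smul_comm]; exact Submodule.smul_mem _ r ht
          | mem t ht =>
            obtain ⟨a, b, hab, rfl⟩ := ht
            exact Submodule.subset_span ⟨x * a, y * b,
              hab.imp (J.mul_mem_left x) (K.mul_mem_left y), by simp⟩ }
  have hI₀ : I₀.restrictScalars R = LinearMap.ker q := rfl
  refine ⟨I₀, fun t ht => ?_, ?_, ?_⟩
  · change t ∈ LinearMap.ker q at ht
    rw [hspan] at ht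
    refine (Submodule.span_le (p := I.restrictScalars R)).mpr ?_ ht
    rintro _ ⟨a, b, hab, rfl⟩
    exact hsub a b hab
  · rw [hI₀]
    exact Module.Finite.equiv (q.quotKerEquivOfSurjective hsurj).symm
  · rw [hI₀]
    exact Module.Projective.of_equiv (q.quotKerEquivOfSurjective hsurj).symm

end Noetherian

/-! ### Laurent polynomials over `R` -/

/-- A monic polynomial `f` annihilating a unit `x` modulo `I` and a monic polynomial `g`
annihilating `x⁻¹` combine to a monic polynomial with constant coefficient `1` annihilating `x`. -/
theorem Ideal.exists_monic_coeff_zero_eq_one {B : Type*} [CommRing B] [Algebra R B] (I : Ideal B)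
    [Module.Finite R (B ⧸ I)] (x : Bˣ) :
    ∃ q : Polynomial R, q.Monic ∧ q.coeff 0 = 1 ∧ Polynomial.aeval (x : B) q ∈ I := by
  open Polynomial in
  rcases subsingleton_or_nontrivial R with _ | _
  · exact ⟨0, Subsingleton.elim _ _, Subsingleton.elim _ _, by simp⟩
  have hint : ∀ y : B, ∃ p : R[X], p.Monic ∧ aeval y p ∈ I := by
    intro y
    obtain ⟨p, hp, hpy⟩ := Algebra.IsIntegral.isIntegral (R := R) (Ideal.Quotient.mk I y)
    refine ⟨p, hp, ?_⟩
    rw [← Ideal.Quotient.eq_zero_iff_mem, ← Ideal.Quotient.mkₐ_eq_mk R, ← aeval_algHom_apply]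
    exact hpy
  obtain ⟨f, hf, hfI⟩ := hint x
  obtain ⟨g, hg, hgI⟩ := hint ↑x⁻¹
  -- `g.reverse` has constant coefficient `1` and degree at most `g.natDegree`; the shift of `f` keeps
  -- the sum monic and does not touch the constant coefficient.
  refine ⟨X ^ (g.natDegree + 1) * f + g.reverse, ?_, ?_, ?_⟩
  · refine ((monic_X_pow _).mul hf).add_of_left (degree_lt_degree ?_)
    rw [((monic_X_pow _).natDegree_mul hf), natDegree_X_pow]
    exact (reverse_natDegree_le g).trans_lt (by omega)
  · simp [mul_coeff_zero, hg.leadingCoeff]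
  · have : aeval (x : B) g.reverse = (x : B) ^ g.natDegree * aeval (↑x⁻¹ : B) g := by
      let : Invertible (↑x⁻¹ : B) := ⟨x, x.mul_inv, x.inv_mul⟩
      rw [mul_comm, aeval_def, aeval_def, ← eval₂_reverse_mul_pow (algebraMap R B) (↑x⁻¹ : B) g,
        mul_assoc, ← mul_pow, x.inv_mul, one_pow, mul_one]
      rfl
    rw [map_add, map_mul, this]
    exact I.add_mem (I.mul_mem_left _ hfI) (I.mul_mem_left _ hgI)

open LaurentPolynomial in
/-- For a monic polynomial `q` with constant coefficient `1`, the class of `X` in `R[X] / (q)` is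
invertible, so that `R[X] / (q)` is also the quotient of the Laurent polynomials by `(q)`. -/
theorem hasPropertyPl_laurentPolynomial : HasPropertyPl R R[T;T⁻¹] := by
  intro I hI
  have : Module.Finite R (R[T;T⁻¹] ⧸ I) := hI
  let t : R[T;T⁻¹]ˣ := ⟨T 1, T (-1), by rw [← T_add, add_neg_cancel, T_zero],
    by rw [← T_add, neg_add_cancel, T_zero]⟩
  obtain ⟨q, hq, hq0, hqI⟩ := I.exists_monic_coeff_zero_eq_one (R := R) t
  have := hq.finite_adjoinRoot
  have := hq.free_adjoinRoot
  -- From `q = X * q.divX + 1` the root has inverse `-q.divX`.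
  let r : (AdjoinRoot q)ˣ := Units.mkOfMulEqOne (AdjoinRoot.root q)
    (-AdjoinRoot.mk q q.divX) (by
      have := congrArg (AdjoinRoot.mk q) q.divX_mul_X_add
      rw [hq0, AdjoinRoot.mk_self] at this
      simp at this
      linear_combination -this)
  let φ : R[T;T⁻¹] →ₐ[R] AdjoinRoot q :=
    { eval₂ (algebraMap R (AdjoinRoot q)) r with
      commutes' := fun c => eval₂_C _ _ c }
  have hφ : ∀ p : Polynomial R, φ (Polynomial.toLaurent p) = AdjoinRoot.mk q p := fun p =>
    (eval₂_toLaurent _ _ p).trans (AdjoinRoot.aeval_eq p)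
  have hsurj : Function.Surjective φ.toLinearMap := fun y => by
    obtain ⟨p, rfl⟩ := AdjoinRoot.mk_surjective y
    exact ⟨_, hφ p⟩
  have hker : (RingHom.ker φ).restrictScalars R = LinearMap.ker φ.toLinearMap := rfl
  refine ⟨RingHom.ker φ, fun f hf => ?_, ?_, ?_⟩
  · obtain ⟨n, p, hp⟩ := f.exists_T_pow
    have hpq : q ∣ p := by
      rw [← AdjoinRoot.mk_eq_zero, ← hφ, hp, map_mul, (RingHom.mem_ker).mp hf, zero_mul]
    obtain ⟨s, rfl⟩ := hpq
    have hqI' : Polynomial.toLaurent q ∈ I := by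
      have := Polynomial.aeval_algHom_apply Polynomial.toLaurentAlg (Polynomial.X : Polynomial R) q
      rw [Polynomial.aeval_X_left_apply, Polynomial.toLaurentAlg_apply,
        Polynomial.toLaurentAlg_apply, Polynomial.toLaurent_X] at this
      rwa [← this]
    have : f = Polynomial.toLaurent (q * s) * T (-n) := by
      rw [hp, mul_assoc, ← T_add, add_neg_cancel, T_zero, mul_one]
    rw [this, map_mul]
    exact I.mul_mem_right _ (I.mul_mem_right _ hqI')
  · rw [hker]
    exact Module.Finite.equiv (φ.toLinearMap.quotKerEquivOfSurjective hsurj).symm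
  · rw [hker]
    exact Module.Projective.of_equiv (φ.toLinearMap.quotKerEquivOfSurjective hsurj).symm

/-! ### Laurent polynomials over an algebra -/

section MonoidAlgebra

variable (A : Type*) [Ring A] [Algebra R A] (G : Type*) [AddMonoid G]

variable (R) in
/-- `A[G] ≃ A ⊗ R[G]`, without commutativity of `A`. -/
noncomputable def AddMonoidAlgebra.tensorAlgEquiv :
    A ⊗[R] AddMonoidAlgebra R G ≃ₐ[R] AddMonoidAlgebra A G :=
  letI := Classical.decEq G
  let φ : A ⊗[R] AddMonoidAlgebra R G →ₐ[R] AddMonoidAlgebra A G :=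
    Algebra.TensorProduct.lift AddMonoidAlgebra.singleZeroAlgHom
      (AddMonoidAlgebra.mapAlgHom G (Algebra.ofId R A)) fun a p => by
        induction p using AddMonoidAlgebra.induction_linear with
        | zero => simp
        | add p q hp hq => rw [map_add]; exact hp.add_right hq
        | single g c => simp [Commute, SemiconjBy, AddMonoidAlgebra.single_mul_single,
            Algebra.ofId_apply, Algebra.commutes]
  let e : A ⊗[R] AddMonoidAlgebra R G ≃ₗ[R] AddMonoidAlgebra A G :=
    TensorProduct.congr (.refl R A) (AddMonoidAlgebra.coeffLinearEquiv R) ≪≫ₗ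
      TensorProduct.finsuppScalarRight R R A G ≪≫ₗ (AddMonoidAlgebra.coeffLinearEquiv R).symm
  AlgEquiv.ofBijective φ <| by
    have : φ.toLinearMap = e := by
      ext a g
      simp [φ, e, Finsupp.single_apply, apply_ite (· • a)]
    change Function.Bijective φ.toLinearMap
    rw [this]
    exact e.bijective

variable {A} [IsNoetherianRing R]

theorem HasPropertyPl.addMonoidAlgebra_int (hA : HasPropertyPl R A) :
    HasPropertyPl R (AddMonoidAlgebra A ℤ) :=
  (hA.tensorProduct hasPropertyPl_laurentPolynomial).of_algEquiv
    (AddMonoidAlgebra.tensorAlgEquiv R A ℤ)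

theorem HasPropertyPl.laurentAlgebra (hA : HasPropertyPl R A) (n : ℕ) :
    HasPropertyPl R (LaurentAlgebra A n) := by
  induction n with
  | zero => exact hA.of_algEquiv (AddMonoidAlgebra.uniqueAlgEquiv R _).symm
  | succ n ih =>
    let e : (Fin (n + 1) → ℤ) ≃+ ℤ × (Fin n → ℤ) :=
      { (Fin.consEquiv fun _ => ℤ).symm with map_add' := fun _ _ => rfl }
    exact ih.addMonoidAlgebra_int.of_algEquiv
      ((AddMonoidAlgebra.domCongr R A e).trans (AddMonoidAlgebra.curryAlgEquiv R)).symm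

end MonoidAlgebra

theorem hasPropertyPl_self : HasPropertyPl R R := by
  intro I hI
  let e := Submodule.quotEquivOfEqBot ((⊥ : Ideal R).restrictScalars R) (by simp)
  exact ⟨⊥, bot_le, Module.Finite.equiv e.symm, Module.Projective.of_equiv e.symm⟩

end PropertyPl

/-! ### Dual bases and tensors over the finite dual -/

section FiniteDualTensor

variable {R : Type*} [CommRing R]

section Algebra

variable {A : Type*} [Ring A] [Algebra R A]

/-- The annihilator `{a | a f = 0}` of a functional `f`. It is the largest left ideal contained in
the kernel of `f`. -/
noncomputable def dualAnnihilator (f : Module.Dual R A) : Ideal A where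
  carrier := {a | ∀ b, f (b * a) = 0}
  zero_mem' b := by simp
  add_mem' ha hb c := by rw [mul_add, map_add, ha, hb, add_zero]
  smul_mem' c a ha b := by rw [smul_eq_mul, ← mul_assoc, ha]

theorem mem_dualAnnihilator {f : Module.Dual R A} {a : A} :
    a ∈ dualAnnihilator f ↔ ∀ b, f (b * a) = 0 := Iff.rfl

variable [IsNoetherianRing R]

theorem isCofiniteLeftIdeal_dualAnnihilator {f : Module.Dual R A} (hf : f ∈ finiteDual R A) :
    IsCofiniteLeftIdeal R (dualAnnihilator f) := by
  have h : (dualAnnihilator f).restrictScalars R = LinearMap.ker (dualOrbit R f) := by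
    ext a
    simp only [Submodule.restrictScalars_mem, mem_dualAnnihilator, LinearMap.mem_ker,
      LinearMap.ext_iff, dualOrbit_apply, LinearMap.zero_apply]
  have : Module.Finite R (LinearMap.range (dualOrbit R f)) := Module.Finite.iff_fg.mpr hf
  unfold IsCofiniteLeftIdeal
  rw [h]
  exact Module.Finite.equiv (dualOrbit R f).quotKerEquivRange.symm

theorem mem_finiteDual_of_cofinite {I : Ideal A} (hI : IsCofiniteLeftIdeal R I)
    {f : Module.Dual R A} (hf : ∀ a ∈ I, f a = 0) : f ∈ finiteDual R A := by
  have : Module.Finite R (A ⧸ I.restrictScalars R) := hI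
  have hle : I.restrictScalars R ≤ LinearMap.ker (dualOrbit R f) := fun a ha => by
    ext b
    exact hf _ (I.mul_mem_left b ha)
  change (LinearMap.range (dualOrbit R f)).FG
  rw [← Submodule.range_liftQ (I.restrictScalars R) (dualOrbit R f) hle]
  exact Module.Finite.iff_fg.mp (Module.Finite.range _)

/-- A finite family of functionals in `A°` vanishes on a left ideal `I` with `A / I` finitely
generated projective, and a dual basis of `A / I` gives the displayed expansion. -/
theorem HasPropertyPl.exists_finiteDual_expansion (hA : HasPropertyPl R A)
    (s : Finset (Module.Dual R A)) (hs : ∀ f ∈ s, f ∈ finiteDual R A) :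
    ∃ (n : ℕ) (e : Fin n → A) (φ : Fin n → Module.Dual R A), (∀ i, φ i ∈ finiteDual R A) ∧
      ∀ f ∈ s, ∀ a b, f (a * b) = ∑ i, f (a * e i) * φ i b := by
  classical
  obtain ⟨J, hJ, hJs⟩ : ∃ J : Ideal A, IsCofiniteLeftIdeal R J ∧
      ∀ f ∈ s, J ≤ dualAnnihilator f := by
    induction s using Finset.induction_on with
    | empty =>
      refine ⟨⊤, ?_, by simp⟩
      change Module.Finite R (A ⧸ (⊤ : Submodule R A))
      infer_instance
    | insert f s _ ih =>
      obtain ⟨J, hJ, hJs⟩ := ih fun g hg => hs g (Finset.mem_insert_of_mem hg)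
      refine ⟨dualAnnihilator f ⊓ J, (isCofiniteLeftIdeal_dualAnnihilator
        (hs f (Finset.mem_insert_self f s))).inf hJ, ?_⟩
      rw [Finset.forall_mem_insert]
      exact ⟨inf_le_left, fun g hg => inf_le_right.trans (hJs g hg)⟩
  obtain ⟨I, hIJ, _, _⟩ := hA J hJ
  obtain ⟨n, p, j, -, -, hpj⟩ :=
    Module.Finite.exists_comp_eq_id_of_projective R (A ⧸ I.restrictScalars R)
  choose e he using fun i => (I.restrictScalars R).mkQ_surjective
    (p fun k => if i = k then 1 else 0)
  let φ : Fin n → Module.Dual R A := fun i =>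
    LinearMap.proj i ∘ₗ j ∘ₗ (I.restrictScalars R).mkQ
  refine ⟨n, e, φ, fun i => mem_finiteDual_of_cofinite (I := I) ‹_› fun a ha => ?_,
    fun f hf a b => ?_⟩
  · have : (I.restrictScalars R).mkQ a = 0 := by simpa using ha
    simp [φ, this]
  · have hb : b - ∑ i, φ i b • e i ∈ I := by
      have : (I.restrictScalars R).mkQ (b - ∑ i, φ i b • e i) = 0 := by
        have h := LinearMap.congr_fun hpj ((I.restrictScalars R).mkQ b)
        rw [LinearMap.comp_apply, LinearMap.pi_apply_eq_sum_univ p] at h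
        rw [map_sub, map_sum, sub_eq_zero]
        simp only [map_smul, he]
        exact h.symm.trans (by simp [φ])
      exact (Submodule.Quotient.mk_eq_zero (I.restrictScalars R)).mp this
    have := hJs f hf (hIJ hb) a
    rw [mul_sub, map_sub, sub_eq_zero, Finset.mul_sum, map_sum] at this
    rw [this]
    exact Finset.sum_congr rfl fun i _ => by rw [mul_smul_comm, map_smul, smul_eq_mul, mul_comm]

end Algebra

section Bialgebra

variable [IsNoetherianRing R] {H : Type*} [Ring H] [Bialgebra R H]

/-- Evaluation of the functionals in `H°` at `a`. -/
noncomputable def finiteDualEval (a : H) : finiteDualAlgebra R H →ₗ[R] R where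
  toFun f := f.1 a
  map_add' _ _ := rfl
  map_smul' _ _ := rfl

@[simp]
theorem finiteDualEval_apply (a : H) (f : finiteDualAlgebra R H) : finiteDualEval a f = f.1 a := rfl

@[ext]
theorem finiteDualAlgebra_ext {f g : finiteDualAlgebra R H} (h : ∀ a, f.1 a = g.1 a) : f = g :=
  Subtype.ext (WithConv.ext (LinearMap.ext h))

theorem HasPropertyPl.exists_finiteDualAlgebra_expansion (hH : HasPropertyPl R H)
    (s : Finset (finiteDualAlgebra R H)) :
    ∃ (n : ℕ) (e : Fin n → H) (φ : Fin n → finiteDualAlgebra R H),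
      ∀ f ∈ s, ∀ a b, f.1 (a * b) = ∑ i, f.1 (a * e i) * (φ i).1 b := by
  classical
  obtain ⟨n, e, φ, hφ, h⟩ := hH.exists_finiteDual_expansion (s.image fun f => f.1.ofConv) (by
    intro f hf
    obtain ⟨g, -, rfl⟩ := Finset.mem_image.mp hf
    exact g.2)
  exact ⟨n, e, fun i => ⟨WithConv.toConv (φ i), hφ i⟩,
    fun f hf => h _ (Finset.mem_image_of_mem _ hf)⟩

/-- The map `H° ⊗ M → Hom(H, M)` is injective: on a given tensor, the identity of `H°` agrees with
a finite-rank projection `f ↦ ∑ f(eᵢ) φᵢ`. -/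
theorem HasPropertyPl.finiteDual_rTensor_ext (hH : HasPropertyPl R H) {M : Type*}
    [AddCommMonoid M] [Module R M] {s t : finiteDualAlgebra R H ⊗[R] M}
    (h : ∀ a, (finiteDualEval a).rTensor M s = (finiteDualEval a).rTensor M t) : s = t := by
  classical
  obtain ⟨S, rfl⟩ := TensorProduct.exists_finset s
  obtain ⟨T, rfl⟩ := TensorProduct.exists_finset t
  obtain ⟨n, e, φ, hφ⟩ := hH.exists_finiteDualAlgebra_expansion ((S ∪ T).image Prod.fst)
  let p : finiteDualAlgebra R H →ₗ[R] finiteDualAlgebra R H :=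
    ∑ i, LinearMap.toSpanSingleton R _ (φ i) ∘ₗ finiteDualEval (e i)
  have hp : ∀ f ∈ (S ∪ T).image Prod.fst, p f = f := by
    intro f hf
    ext b
    have := hφ f hf 1 b
    simp only [one_mul] at this
    rw [this, ← finiteDualEval_apply b]
    simp [p]
  have hfix : ∀ U ⊆ S ∪ T, p.rTensor M (∑ i ∈ U, i.1 ⊗ₜ[R] i.2) = ∑ i ∈ U, i.1 ⊗ₜ[R] i.2 := by
    intro U hU
    rw [map_sum]
    refine Finset.sum_congr rfl fun i hi => ?_
    rw [LinearMap.rTensor_tmul, hp _ (Finset.mem_image_of_mem _ (hU hi))]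
  rw [← hfix S Finset.subset_union_left, ← hfix T Finset.subset_union_right]
  -- `p ⊗ id` factors through the evaluations at the `eᵢ`, where `s` and `t` agree.
  have hsum : ∀ u, p.rTensor M u = ∑ i, (LinearMap.toSpanSingleton R _ (φ i)).rTensor M
      ((finiteDualEval (e i)).rTensor M u) := by
    intro u
    change LinearMap.rTensorHom M p u = _
    simp only [p, map_sum, LinearMap.sum_apply, LinearMap.coe_rTensorHom,
      LinearMap.rTensor_comp_apply]
  simp only [hsum, h]

/-- Evaluation of tensors in `H° ⊗ H°` at `(a, b)`. -/
noncomputable def finiteDualEval₂ (a b : H) : finiteDualAlgebra R H ⊗[R] finiteDualAlgebra R H →ₗ[R] R :=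
  LinearMap.mul' R R ∘ₗ TensorProduct.map (finiteDualEval a) (finiteDualEval b)

@[simp]
theorem finiteDualEval₂_tmul (a b : H) (f g : finiteDualAlgebra R H) :
    finiteDualEval₂ a b (f ⊗ₜ g) = f.1 a * g.1 b := rfl

/-- Evaluation of tensors in `H° ⊗ (H° ⊗ H°)` at `(a, b, c)`. -/
noncomputable def finiteDualEval₃ (a b c : H) : finiteDualAlgebra R H ⊗[R]
    (finiteDualAlgebra R H ⊗[R] finiteDualAlgebra R H) →ₗ[R] R :=
  LinearMap.mul' R R ∘ₗ TensorProduct.map (finiteDualEval a) (finiteDualEval₂ b c)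

theorem HasPropertyPl.finiteDual_tensor_ext (hH : HasPropertyPl R H)
    {s t : finiteDualAlgebra R H ⊗[R] finiteDualAlgebra R H}
    (h : ∀ a b, finiteDualEval₂ a b s = finiteDualEval₂ a b t) : s = t := by
  refine hH.finiteDual_rTensor_ext fun a => (TensorProduct.lid R _).injective ?_
  ext b
  have key : finiteDualEval b ∘ₗ (TensorProduct.lid R _).toLinearMap ∘ₗ
      (finiteDualEval a).rTensor (finiteDualAlgebra R H) = finiteDualEval₂ a b :=
    TensorProduct.ext' fun _ _ => rfl
  exact (LinearMap.congr_fun key s).trans ((h a b).trans (LinearMap.congr_fun key t).symm)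

theorem HasPropertyPl.finiteDual_tensor_ext₃ (hH : HasPropertyPl R H)
    {s t : finiteDualAlgebra R H ⊗[R] (finiteDualAlgebra R H ⊗[R] finiteDualAlgebra R H)}
    (h : ∀ a b c, finiteDualEval₃ a b c s = finiteDualEval₃ a b c t) : s = t := by
  refine hH.finiteDual_rTensor_ext fun a => (TensorProduct.lid R _).injective ?_
  refine hH.finiteDual_tensor_ext fun b c => ?_
  have key : finiteDualEval₂ b c ∘ₗ (TensorProduct.lid R _).toLinearMap ∘ₗ
      (finiteDualEval a).rTensor (finiteDualAlgebra R H ⊗[R] finiteDualAlgebra R H) =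
      finiteDualEval₃ a b c :=
    TensorProduct.ext' fun _ _ => map_smul (finiteDualEval₂ b c) _ _
  exact (LinearMap.congr_fun key s).trans ((h a b c).trans (LinearMap.congr_fun key t).symm)

end Bialgebra

end FiniteDualTensor

/-! ### The dual Hopf algebra -/

section DualHopf

variable {R : Type*} [CommRing R] [IsNoetherianRing R]

section Bialgebra

variable {H : Type*} [Ring H] [Bialgebra R H]

theorem HasPropertyPl.exists_finiteDual_comul (hH : HasPropertyPl R H)
    (f : finiteDualAlgebra R H) :
    ∃ t : finiteDualAlgebra R H ⊗[R] finiteDualAlgebra R H,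
      ∀ a b, finiteDualEval₂ a b t = f.1 (a * b) := by
  obtain ⟨n, e, φ, h⟩ := hH.exists_finiteDualAlgebra_expansion {f}
  -- `H (c f) ⊆ H f`
  have hmem : ∀ c, dualOrbit R f.1.ofConv c ∈ finiteDual R H := by
    intro c
    refine Submodule.FG.of_le f.2 ?_
    rintro _ ⟨a, rfl⟩
    refine ⟨a * c, ?_⟩
    ext b
    simp only [dualOrbit_apply, mul_assoc]
  refine ⟨∑ i, (⟨WithConv.toConv (dualOrbit R f.1.ofConv (e i)), hmem _⟩ :
    finiteDualAlgebra R H) ⊗ₜ[R] φ i, fun a b => ?_⟩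
  rw [h f (Finset.mem_singleton_self f), map_sum]
  rfl

/-- The comultiplication of `H°`, characterised by `(Δ f)(a ⊗ b) = f (a b)`. -/
noncomputable def finiteDualComul (hH : HasPropertyPl R H) : finiteDualAlgebra R H →ₗ[R]
    finiteDualAlgebra R H ⊗[R] finiteDualAlgebra R H where
  toFun f := (hH.exists_finiteDual_comul f).choose
  map_add' f g := hH.finiteDual_tensor_ext fun a b => by
    rw [map_add]
    simp only [(hH.exists_finiteDual_comul _).choose_spec]
    rfl
  map_smul' c f := hH.finiteDual_tensor_ext fun a b => by
    rw [map_smul]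
    simp only [(hH.exists_finiteDual_comul _).choose_spec]
    rfl

@[simp]
theorem finiteDualEval₂_comul (hH : HasPropertyPl R H) (f : finiteDualAlgebra R H) (a b : H) :
    finiteDualEval₂ a b (finiteDualComul hH f) = f.1 (a * b) :=
  (hH.exists_finiteDual_comul f).choose_spec a b

theorem finiteDualAlgebra_mul_apply (f g : finiteDualAlgebra R H) {a : H} {ι : Type*}
    (r : Coalgebra.Repr R a ι) :
    (f * g).1 a = ∑ i ∈ r.index, f.1 (r.left i) * g.1 (r.right i) :=
  r.convMul_apply f.1 g.1

theorem finiteDualAlgebra_one_apply (a : H) :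
    (1 : finiteDualAlgebra R H).1 a = Coalgebra.counit (R := R) a := rfl

theorem finiteDualEval₂_mul (s t : finiteDualAlgebra R H ⊗[R] finiteDualAlgebra R H) {a b : H}
    {ι κ : Type*} (p : Coalgebra.Repr R a ι) (q : Coalgebra.Repr R b κ) :
    finiteDualEval₂ a b (s * t) = ∑ i ∈ p.index, ∑ j ∈ q.index,
      finiteDualEval₂ (p.left i) (q.left j) s * finiteDualEval₂ (p.right i) (q.right j) t := by
  induction s with
  | zero => simp
  | add x y hx hy => simp only [add_mul, map_add, hx, hy, Finset.sum_add_distrib]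
  | tmul f f' =>
    induction t with
    | zero => simp
    | add x y hx hy => simp only [mul_add, map_add, hx, hy, Finset.sum_add_distrib]
    | tmul g g' =>
      rw [Algebra.TensorProduct.tmul_mul_tmul, finiteDualEval₂_tmul,
        finiteDualAlgebra_mul_apply f g p, finiteDualAlgebra_mul_apply f' g' q,
        Finset.sum_mul_sum]
      simp only [finiteDualEval₂_tmul]
      exact Finset.sum_congr rfl fun i _ => Finset.sum_congr rfl fun j _ => mul_mul_mul_comm _ _ _ _

theorem finiteDualComul_mul (hH : HasPropertyPl R H) (f g : finiteDualAlgebra R H) :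
    finiteDualComul hH (f * g) = finiteDualComul hH f * finiteDualComul hH g := by
  refine hH.finiteDual_tensor_ext fun a b => ?_
  let p := Coalgebra.Repr.arbitrary R a
  let q := Coalgebra.Repr.arbitrary R b
  rw [finiteDualEval₂_mul _ _ p q, finiteDualEval₂_comul,
    finiteDualAlgebra_mul_apply f g (p.mul q)]
  simp only [finiteDualEval₂_comul]
  exact Finset.sum_product _ _ _

theorem finiteDualComul_one (hH : HasPropertyPl R H) :
    finiteDualComul hH (1 : finiteDualAlgebra R H) = 1 := by
  refine hH.finiteDual_tensor_ext fun a b => ?_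
  rw [finiteDualEval₂_comul, Algebra.TensorProduct.one_def, finiteDualEval₂_tmul]
  simp only [finiteDualAlgebra_one_apply, Bialgebra.counit_mul]

/-- The coalgebra `H°` dual to the algebra `H`. -/
@[reducible]
noncomputable def finiteDualCoalgebra (hH : HasPropertyPl R H) : Coalgebra R (finiteDualAlgebra R H) where
  comul := finiteDualComul hH
  counit := finiteDualEval 1
  coassoc := by
    refine LinearMap.ext fun f => hH.finiteDual_tensor_ext₃ fun a b c => ?_
    have hl : finiteDualEval₃ a b c ∘ₗ (TensorProduct.assoc R _ _ _).toLinearMap ∘ₗ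
        (finiteDualComul hH).rTensor _ = finiteDualEval₂ (a * b) c := by
      refine TensorProduct.ext' fun g h => ?_
      have : finiteDualEval₃ a b c ∘ₗ (TensorProduct.assoc R _ _ _).toLinearMap ∘ₗ
          (TensorProduct.mk R _ _).flip h = h.1 c • finiteDualEval₂ a b :=
        TensorProduct.ext' fun x y => by
          change x.1 a * (y.1 b * h.1 c) = h.1 c * (x.1 a * y.1 b)
          ring
      refine (LinearMap.congr_fun this (finiteDualComul hH g)).trans ?_
      rw [LinearMap.smul_apply, finiteDualEval₂_comul, finiteDualEval₂_tmul, smul_eq_mul, mul_comm]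
    have hr : finiteDualEval₃ a b c ∘ₗ (finiteDualComul hH).lTensor _ =
        finiteDualEval₂ a (b * c) :=
      TensorProduct.ext' fun g h => congrArg (g.1 a * ·) (finiteDualEval₂_comul hH h b c)
    refine (LinearMap.congr_fun hl _).trans (.trans ?_ (LinearMap.congr_fun hr _).symm)
    rw [finiteDualEval₂_comul, finiteDualEval₂_comul, mul_assoc]
  rTensor_counit_comp_comul := by
    refine LinearMap.ext fun f => (TensorProduct.lid R _).injective ?_
    ext b
    have h : finiteDualEval b ∘ₗ (TensorProduct.lid R _).toLinearMap ∘ₗ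
        (finiteDualEval 1).rTensor _ = finiteDualEval₂ 1 b := TensorProduct.ext' fun _ _ => rfl
    refine (LinearMap.congr_fun h (finiteDualComul hH f)).trans ?_
    rw [finiteDualEval₂_comul, one_mul, TensorProduct.mk_apply, TensorProduct.lid_tmul, one_smul]
  lTensor_counit_comp_comul := by
    refine LinearMap.ext fun f => (TensorProduct.rid R _).injective ?_
    ext b
    have h : finiteDualEval b ∘ₗ (TensorProduct.rid R _).toLinearMap ∘ₗ
        (finiteDualEval 1).lTensor _ = finiteDualEval₂ b 1 :=
      TensorProduct.ext' fun _ _ => mul_comm _ _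
    refine (LinearMap.congr_fun h (finiteDualComul hH f)).trans ?_
    rw [finiteDualEval₂_comul, mul_one, LinearMap.flip_apply, TensorProduct.mk_apply,
      TensorProduct.rid_tmul, one_smul]

theorem finiteDualEval_one_mul (f g : finiteDualAlgebra R H) :
    finiteDualEval 1 (f * g) = finiteDualEval 1 f * finiteDualEval 1 g := by
  -- `Δ(1) = 1 ⊗ 1`
  let p : Coalgebra.Repr R (1 : H) Unit := ⟨Finset.univ, fun _ => 1, fun _ => 1, by
    simp [Algebra.TensorProduct.one_def]⟩
  exact (finiteDualAlgebra_mul_apply f g p).trans (by simp [p])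

/-- The bialgebra `H°` dual to the bialgebra `H`. -/
@[reducible]
noncomputable def finiteDualBialgebra (hH : HasPropertyPl R H) : Bialgebra R (finiteDualAlgebra R H) where
  __ := finiteDualCoalgebra hH
  counit_one := Bialgebra.counit_one (R := R) (A := H)
  mul_compr₂_counit := LinearMap.ext₂ finiteDualEval_one_mul
  comul_one := finiteDualComul_one hH
  mul_compr₂_comul := LinearMap.ext₂ (finiteDualComul_mul hH)

end Bialgebra

section HopfAlgebra

variable {H : Type*} [Ring H] [HopfAlgebra R H]

/-- If `f (x y) = ∑ f (x eᵢ) φᵢ(y)`, then `f (S (b a)) = ∑ f (S(a) eᵢ) φᵢ(S(b))`, so that the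
orbit of `f ∘ S` lies in the span of the `φᵢ ∘ S`. -/
theorem HasPropertyPl.comp_antipode_mem_finiteDual (hH : HasPropertyPl R H)
    {f : Module.Dual R H} (hf : f ∈ finiteDual R H) :
    f ∘ₗ HopfAlgebra.antipode R ∈ finiteDual R H := by
  obtain ⟨n, e, φ, -, h⟩ := hH.exists_finiteDual_expansion {f} (by simpa using hf)
  refine Submodule.FG.of_le (Submodule.fg_span (Set.finite_range fun i =>
    (φ i ∘ₗ HopfAlgebra.antipode R : Module.Dual R H))) ?_
  rintro _ ⟨a, rfl⟩
  have : dualOrbit R (f ∘ₗ HopfAlgebra.antipode R) a =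
      ∑ i, f (HopfAlgebra.antipode R a * e i) • (φ i ∘ₗ HopfAlgebra.antipode R) := by
    ext b
    rw [dualOrbit_apply, LinearMap.comp_apply, HopfAlgebra.antipode_mul_antidistrib,
      h f (Finset.mem_singleton_self f)]
    simp
  rw [this]
  exact Submodule.sum_mem _ fun i _ => Submodule.smul_mem _ _ (Submodule.subset_span ⟨i, rfl⟩)

/-- The antipode `f ↦ f ∘ S` of `H°`. -/
noncomputable def finiteDualAntipode (hH : HasPropertyPl R H) :
    finiteDualAlgebra R H →ₗ[R] finiteDualAlgebra R H where
  toFun f := ⟨WithConv.toConv (f.1.ofConv ∘ₗ HopfAlgebra.antipode R),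
    hH.comp_antipode_mem_finiteDual f.2⟩
  map_add' _ _ := rfl
  map_smul' _ _ := rfl

/-- The Hopf algebra `H°` dual to the Hopf algebra `H`. -/
@[reducible]
noncomputable def finiteDualHopfAlgebra (hH : HasPropertyPl R H) : HopfAlgebra R (finiteDualAlgebra R H) where
  __ := finiteDualBialgebra hH
  antipode := finiteDualAntipode hH
  mul_antipode_rTensor_comul := by
    refine LinearMap.ext fun f => finiteDualAlgebra_ext fun a => ?_
    let r := Coalgebra.Repr.arbitrary R a
    have h : finiteDualEval a ∘ₗ LinearMap.mul' R _ ∘ₗ (finiteDualAntipode hH).rTensor _ =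
        ∑ i ∈ r.index, finiteDualEval₂ (HopfAlgebra.antipode R (r.left i)) (r.right i) := by
      refine TensorProduct.ext' fun f g => ?_
      rw [LinearMap.sum_apply]
      exact finiteDualAlgebra_mul_apply _ _ r
    refine (LinearMap.congr_fun h (finiteDualComul hH f)).trans ?_
    rw [LinearMap.sum_apply]
    simp only [finiteDualEval₂_comul]
    rw [← map_sum f.1.ofConv, HopfAlgebra.sum_antipode_mul_eq_smul, map_smul]
    exact mul_comm _ _
  mul_antipode_lTensor_comul := by
    refine LinearMap.ext fun f => finiteDualAlgebra_ext fun a => ?_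
    let r := Coalgebra.Repr.arbitrary R a
    have h : finiteDualEval a ∘ₗ LinearMap.mul' R _ ∘ₗ (finiteDualAntipode hH).lTensor _ =
        ∑ i ∈ r.index, finiteDualEval₂ (r.left i) (HopfAlgebra.antipode R (r.right i)) := by
      refine TensorProduct.ext' fun f g => ?_
      rw [LinearMap.sum_apply]
      exact finiteDualAlgebra_mul_apply _ _ r
    refine (LinearMap.congr_fun h (finiteDualComul hH f)).trans ?_
    rw [LinearMap.sum_apply]
    simp only [finiteDualEval₂_comul]
    rw [← map_sum f.1.ofConv, HopfAlgebra.sum_mul_antipode_eq_smul, map_smul]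
    exact mul_comm _ _

theorem isDualHopfStructure_finiteDualHopfAlgebra (hH : HasPropertyPl R H) :
    IsDualHopfStructure R H (finiteDualHopfAlgebra hH) where
  toAlgebra_eq := rfl
  dual :=
    letI := finiteDualHopfAlgebra hH
    { comul_eval := fun f r a b => by
        rw [← finiteDualEval₂_comul hH f a b]
        change finiteDualEval₂ a b (Coalgebra.comul (R := R) f) = _
        rw [← r.eq, map_sum]
        rfl
      counit_eval := fun _ => rfl
      antipode_eval := fun _ _ => rfl }

end HopfAlgebra

end DualHopf

theorem mainTheorem4 (R : Type u) [CommRing R] [IsNoetherianRing R] (n : ℕ) :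
    (∀ (A : Type v) [Ring A] [Algebra R A],
      HasPropertyPl R A → HasPropertyPl R (LaurentAlgebra A n)) ∧
    ∃ h : HopfAlgebra R (finiteDualAlgebra R (LaurentAlgebra R n)),
      IsDualHopfStructure R (LaurentAlgebra R n) h := by
  have hP : HasPropertyPl R (LaurentAlgebra R n) := hasPropertyPl_self.laurentAlgebra n
  exact ⟨fun _ _ _ hA => hA.laurentAlgebra n,
    finiteDualHopfAlgebra hP, isDualHopfStructure_finiteDualHopfAlgebra hP⟩
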